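/- Let $k$ be a field of characteristic zero, let $R$ be a $k$-algebra which is a unique factorization domain, and let $B=R[X_1,X_2]$ be the polynomial ring in two variables over $R$. Let $D$ be a locally nilpotent $R$-derivation of $B$ (that is, $D$ is an $R$-derivation of $B$ and for each $b\in B$ there is $n\in\mathbb N$ with $D^n b=0$). Assume that: - $D$ is irreducible, i.e. there is no non-unit $b\in B$ with $DB\subseteq bB$; - $D$ is not fixed point free, i.e. the ideal $(DB)B$ of $B$ generated by the image of $D$ is not equal to $B$; - $D^2X_1=0$ and $DX_1$ is an irreducible element of $B$. Let $A=\mathrm{Ker}(D)=\{b\in B : Db=0\}$ and let $I_1=A\cap DB$ be the plinth ideal of $D$, an ideal of $A$. Then the following are equivalent: 1. $I_1$ is a principal ideal of $A$; 2. $I_1=(DX_1)A$; 3. $D$ is strictly $1$-quasi-nice. Here, for $m\in\{1,2\}$, a locally nilpotent $R$-derivation $D$ of $B$ is called $m$-quasi-nice if there is a coordinate system $(Y_1,Y_2)$ of $B$ (i.e. $B=R[Y_1,Y_2]$ is the polynomial ring over $R$ in $Y_1,Y_2$) such that $D^2Y_i=0$ for all $1\le i\le m$; it is strictly $1$-quasi-nice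 if it is $1$-quasi-nice but not $2$-quasi-nice. -/

import Mathlib

namespace LND

section General

variable {R B : Type*} [CommRing R] [CommRing B] [Algebra R B]

/-- `D` is locally nilpotent: every element is killed by some iterate of `D`. -/
def IsLocallyNilpotent (D : Derivation R B B) : Prop :=
  ∀ b : B, ∃ n : ℕ, D^[n] b = 0

/-- `D` is irreducible: no non-unit `b` of `B` satisfies `D B ⊆ b B`. -/
def IsIrreducible (D : Derivation R B B) : Prop :=
  ¬ ∃ b : B, ¬ IsUnit b ∧ ∀ x : B, D x ∈ Ideal.span {b}

/-- `D` is fixed point free: the ideal of `B` generated by `D B` is `B`. -/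
def IsFixedPointFree (D : Derivation R B B) : Prop :=
  Ideal.span (Set.range D) = ⊤

/-- The kernel of `D`, as an `R`-subalgebra of `B`. -/
def ker (D : Derivation R B B) : Subalgebra R B where
  carrier := {b | D b = 0}
  mul_mem' := by
    intro a b ha hb
    simp only [Set.mem_ofPred_eq] at ha hb ⊢
    simp [ha, hb]
  add_mem' := by
    intro a b ha hb
    simp only [Set.mem_ofPred_eq] at ha hb ⊢
    simp [ha, hb]
  algebraMap_mem' := fun r => D.map_algebraMap r

theorem mem_ker (D : Derivation R B B) {b : B} : b ∈ ker D ↔ D b = 0 := Iff.rfl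

theorem iterate_ker_mul (D : Derivation R B B) (a : ker D) (n : ℕ) (b : B) :
    D^[n] ((a : B) * b) = (a : B) * D^[n] b := by
  have ha : D (a : B) = 0 := a.2
  induction n generalizing b with
  | zero => rfl
  | succ n ih =>
    have h : D ((a : B) * b) = (a : B) * D b := by simp [ha]
    rw [Function.iterate_succ_apply, Function.iterate_succ_apply, h, ih]

/-- The `n`-th image ideal `Ker D ∩ Dⁿ B`, an ideal of `Ker D`. -/
def imageIdeal (D : Derivation R B B) (n : ℕ) : Ideal (ker D) where
  carrier := {a | ∃ b : B, D^[n] b = (a : B)}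
  add_mem' := by
    rintro a a' ⟨b, hb⟩ ⟨b', hb'⟩
    exact ⟨b + b', by rw [iterate_map_add, hb, hb']; rfl⟩
  zero_mem' := ⟨0, by rw [iterate_map_zero]; rfl⟩
  smul_mem' := by
    rintro c a ⟨b, hb⟩
    exact ⟨(c : B) * b, by rw [iterate_ker_mul, hb]; rfl⟩

/-- The plinth ideal of `D`, that is, its first image ideal `Ker D ∩ D B`. -/
def plinthIdeal (D : Derivation R B B) : Ideal (ker D) := imageIdeal D 1

/-- `(x₁, …, xₙ)` is a coordinate system of `B` over `R`: `B` is the polynomial ring over `R`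
in `x₁, …, xₙ`. -/
def IsCoordinateSystem (R : Type*) {B : Type*} [CommRing R] [CommRing B] [Algebra R B] {n : ℕ}
    (x : Fin n → B) : Prop :=
  Function.Bijective (MvPolynomial.aeval x : MvPolynomial (Fin n) R →ₐ[R] B)

end General

section Polynomial

variable {R : Type*} [CommRing R] {n : ℕ}

/-- `D` is an `m`-quasi-nice locally nilpotent `R`-derivation of the polynomial ring in `n`
variables (`1 ≤ m ≤ n`): some coordinate system has its first `m` members killed by `D²`. -/
def IsQuasiNice (D : Derivation R (MvPolynomial (Fin n) R) (MvPolynomial (Fin n) R)) (m : ℕ) :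
    Prop :=
  IsLocallyNilpotent D ∧ 1 ≤ m ∧ m ≤ n ∧
    ∃ x : Fin n → MvPolynomial (Fin n) R, IsCoordinateSystem R x ∧
      ∀ i : Fin n, (i : ℕ) < m → D (D (x i)) = 0

/-- `D` is strictly `m`-quasi-nice: `m`-quasi-nice, but not `r`-quasi-nice for any `r > m`. -/
def IsStrictlyQuasiNice (D : Derivation R (MvPolynomial (Fin n) R) (MvPolynomial (Fin n) R))
    (m : ℕ) : Prop :=
  IsQuasiNice D m ∧ ∀ r : ℕ, m < r → ¬ IsQuasiNice D r

end Polynomial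

end LND

namespace LND

open Polynomial

/-! ### Derivations of `R[X][X]`: write x for the inner variable `C X` and y for the outer `X`. -/

section Bivariate

variable {R : Type*} [CommRing R]

/-! If the plinth ideal has a generator q and both members of a coordinate system are killed by D²,
then q divides D of each coordinate, hence all of DB. Irreducibility makes q a unit, and D is fixed
point free (`IsIrreducible.isFixedPointFree_of_isPrincipal`). This gives 1 → 3.

The substance of 3 → 2 is that a plinth element Db not divisible by Dx yields a second coordinate
killed by D². First, Dx = r is a prime of R and Dy = g(x). With G' = g, the kernel is R[F], F = ry -
G (`exists_eq_aeval`). Reducing the kernel element Db·x - rb modulo r and y forces G to have degree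
1 modulo r (`natDegree_map_eq_one`). So g is a constant c plus r·a'(x), and D(y - a(x)) = c lies in
R. -/

/-- The chain rule, with Q in the role of ∂P/∂x. -/
theorem exists_eq_mul_add_mul_derivative (D : Derivation R R[X][X] R[X][X]) (P : R[X][X]) :
    ∃ Q : R[X][X], (∀ n, Q.coeff n = derivative (P.coeff n)) ∧
      D P = D (C X) * Q + D X * derivative P := by
  induction P using Polynomial.induction_on' with
  | add P P' h h' =>
    obtain ⟨Q, hQ, hD⟩ := h
    obtain ⟨Q', hQ', hD'⟩ := h'
    exact ⟨Q + Q', fun n => by simp [hQ, hQ'], by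
      rw [map_add, hD, hD', derivative_add]; ring⟩
  | monomial n a =>
    refine ⟨monomial n (derivative a), fun m => ?_, ?_⟩
    · simp only [coeff_monomial]
      split_ifs <;> simp
    · have hC : D (C a) = C (derivative a) * D (C X) := by
        induction a using Polynomial.induction_on' with
        | add a a' h h' => simp only [map_add, h, h']; ring
        | monomial m r =>
          have hr : D (C (C r)) = 0 := D.map_algebraMap r
          rw [← C_mul_X_pow_eq_monomial, map_mul, map_pow, D.leibniz, hr, D.leibniz_pow,
            derivative_C_mul_X_pow]
          simp only [smul_eq_mul, nsmul_eq_mul, map_mul, map_pow, map_natCast]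
          ring
      rw [← C_mul_X_pow_eq_monomial, ← C_mul_X_pow_eq_monomial, D.leibniz, hC, D.leibniz_pow,
        derivative_C_mul_X_pow]
      simp only [smul_eq_mul, nsmul_eq_mul, map_mul, map_natCast]
      ring

/-- The prime p = Dx divides Dy·∂p/∂y because Dp = 0, and cannot divide Dy by irreducibility of D.
So p divides ∂p/∂y, which vanishes by degree; then ∂p/∂x vanishes too. -/
theorem IsIrreducible.exists_apply_C_X_eq [IsDomain R] [UniqueFactorizationMonoid R] [CharZero R]
    {D : Derivation R R[X][X] R[X][X]} (hirr : IsIrreducible D)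
    (hD2 : D (D (C X)) = 0) (hDX : Irreducible (D (C X))) :
    ∃ r : R, D (C X) = C (C r) := by
  obtain ⟨Q, hQ, hD⟩ := exists_eq_mul_add_mul_derivative D (D (C X))
  have hp : Prime (D (C X)) := hDX.prime
  have hdvd : D (C X) ∣ D X * derivative (D (C X)) := by
    rw [hD2] at hD
    exact ⟨-Q, by linear_combination -hD⟩
  have hder : derivative (D (C X)) = 0 := by
    rcases hp.dvd_or_dvd hdvd with h | h
    · refine absurd ⟨D (C X), hDX.not_isUnit, fun P => ?_⟩ hirr
      obtain ⟨Q', -, hD'⟩ := exists_eq_mul_add_mul_derivative D P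
      rw [Ideal.mem_span_singleton, hD']
      exact dvd_add (dvd_mul_right _ _) (h.mul_right _)
    · by_contra h0
      exact absurd h (not_dvd_of_degree_lt h0 (degree_derivative_lt hDX.ne_zero))
  obtain ⟨a, ha⟩ : ∃ a, D (C X) = C a := ⟨_, eq_C_of_derivative_eq_zero hder⟩
  have hQ0 : Q = 0 := by
    rw [hD2, hder, mul_zero, add_zero, eq_comm, mul_eq_zero] at hD
    exact hD.resolve_left hDX.ne_zero
  have hda : derivative a = 0 := by
    have := hQ 0
    rw [hQ0, ha] at this
    simpa using this.symm
  exact ⟨a.coeff 0, by rw [ha, ← eq_C_of_derivative_eq_zero hda]⟩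

/-- Were Dy of positive degree in y, D would preserve positivity of the y-degree, so no iterate
could kill y. -/
theorem IsLocallyNilpotent.exists_apply_X_eq [IsDomain R] [CharZero R]
    {D : Derivation R R[X][X] R[X][X]} (hnil : IsLocallyNilpotent D) {r : R}
    (hr : D (C X) = C (C r)) : ∃ g : R[X], D X = C g := by
  by_contra! hg
  have hm : (D X).natDegree ≠ 0 := fun h => hg _ (eq_C_of_natDegree_eq_zero h)
  have hDX0 : D X ≠ 0 := fun h => hm (by simp [h])
  have step : ∀ P : R[X][X], P.natDegree ≠ 0 → (D P).natDegree ≠ 0 := by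
    intro P hP
    obtain ⟨Q, hQ, hD⟩ := exists_eq_mul_add_mul_derivative D P
    have hP0 : P ≠ 0 := fun h => hP (by simp [h])
    obtain ⟨e, he⟩ := Nat.exists_eq_succ_of_ne_zero hP
    obtain ⟨m, hm'⟩ := Nat.exists_eq_succ_of_ne_zero hm
    have hl : P.coeff (e + 1) ≠ 0 := by
      have := leadingCoeff_ne_zero.2 hP0
      rwa [leadingCoeff, he] at this
    have hc : (D X).coeff (m + 1) ≠ 0 := by
      have := leadingCoeff_ne_zero.2 hDX0
      rwa [leadingCoeff, hm'] at this
    have hd : (derivative P).natDegree ≤ e := by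
      have := natDegree_derivative_le P
      omega
    have hcoeff : (D P).coeff (m + 1 + e) =
        C r * derivative (P.coeff (m + 1 + e)) +
          (D X).coeff (m + 1) * (P.coeff (e + 1) * ((e : R[X]) + 1)) := by
      rw [hD, hr, coeff_add, coeff_C_mul, hQ,
        coeff_mul_add_eq_of_natDegree_le (le_of_eq hm') hd, coeff_derivative]
    have he0 : ((e : R[X]) + 1) ≠ 0 := by exact_mod_cast e.succ_ne_zero
    have hne : (D P).coeff (m + 1 + e) ≠ 0 := by
      rw [hcoeff]
      -- Only for m = 0 do both terms contribute; they cannot cancel, since differentiating the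
      -- leading coefficient lowers its x-degree.
      rcases Nat.eq_zero_or_pos m with rfl | hm0
      · rw [show 0 + 1 + e = e + 1 by ring]
        intro h0
        have hlt : (C r * derivative (P.coeff (e + 1))).degree <
            ((D X).coeff (0 + 1) * (P.coeff (e + 1) * ((e : R[X]) + 1))).degree := by
          rw [mul_comm (P.coeff (e + 1)), ← mul_assoc, degree_mul (q := P.coeff (e + 1))]
          have h1 : (0 : WithBot ℕ) ≤ ((D X).coeff (0 + 1) * ((e : R[X]) + 1)).degree :=
            zero_le_degree_iff.2 (mul_ne_zero hc he0)
          calc (C r * derivative (P.coeff (e + 1))).degree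
              ≤ (derivative (P.coeff (e + 1))).degree := by
                by_cases h : r = 0
                · simp [h]
                · rw [degree_C_mul h]
            _ < (P.coeff (e + 1)).degree := degree_derivative_lt hl
            _ ≤ _ := le_add_of_nonneg_left h1
        rw [add_eq_zero_iff_eq_neg] at h0
        rw [h0, degree_neg] at hlt
        exact lt_irrefl _ hlt
      · rw [coeff_eq_zero_of_natDegree_lt (by omega : P.natDegree < m + 1 + e)]
        simpa using ⟨hc, hl, he0⟩
    have := le_natDegree_of_ne_zero hne
    omega
  obtain ⟨n, hn⟩ := hnil X
  have hiter : ∀ n, (D^[n] X).natDegree ≠ 0 := by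
    intro n
    induction n with
    | zero => simp
    | succ n ih => rw [Function.iterate_succ_apply']; exact step _ ih
  exact hiter n (by simp [hn])

/-- Every element of the kernel of `r ∂ₓ + g ∂ᵧ` becomes a polynomial in `r Y - ∫ g` after
multiplication by a power of `r`. -/
theorem exists_pow_mul_eq_aeval [IsDomain R] [CharZero R]
    {D : Derivation R R[X][X] R[X][X]} {r : R} (hr0 : r ≠ 0) {G : R[X]}
    (hr : D (C X) = C (C r)) (hg : D X = C (derivative G)) (b : R[X][X]) (hb : D b = 0) :
    ∃ (N : ℕ) (φ : R[X]), C (C r) ^ N * b = aeval (C (C r) * X - C G : R[X][X]) φ := by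
  induction hn : b.natDegree using Nat.strong_induction_on generalizing b with
  | _ n ih =>
    obtain ⟨Q, hQ, hD⟩ := exists_eq_mul_add_mul_derivative D b
    have hlead : derivative (b.coeff n) = 0 := by
      have h := congrArg (fun P => coeff P n) hD
      simp only [hb, hr, hg, coeff_zero, coeff_add, coeff_C_mul, hQ, coeff_derivative] at h
      rw [coeff_eq_zero_of_natDegree_lt (by omega : b.natDegree < n + 1)] at h
      simpa [hr0] using h.symm
    obtain ⟨c, hc⟩ : ∃ c, b.coeff n = C c := ⟨_, eq_C_of_derivative_eq_zero hlead⟩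
    rcases Nat.eq_zero_or_pos n with rfl | hn0
    · exact ⟨0, C c, by rw [pow_zero, one_mul, aeval_C, eq_C_of_natDegree_eq_zero hn, hc]; rfl⟩
    set F : R[X][X] := C (C r) * X - C G with hF
    have hDF : D F = 0 := by
      obtain ⟨Q, hQ, hD⟩ := exists_eq_mul_add_mul_derivative D F
      have hQ' : Q = C (- derivative G) := by
        ext1 i
        rw [hQ]
        rcases i with _ | _ | i <;> simp [hF, coeff_X, coeff_C]
      rw [hD, hQ', hr, hg, hF]
      simp only [derivative_sub, derivative_mul, derivative_C, derivative_X, C_neg]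
      ring
    have hDr : D (C (C r)) = 0 := D.map_algebraMap r
    have hDc : D (C (C c)) = 0 := D.map_algebraMap c
    have hF1 : F.natDegree ≤ 1 := by
      rw [hF, sub_eq_add_neg, ← C_neg]; exact natDegree_linear_le
    have hFc : F.coeff 1 = C r := by simp [hF, coeff_C]
    -- Both terms have y^n-coefficient r^n c, so the y-degree drops while b' stays in the kernel.
    set b' : R[X][X] := C (C r) ^ n * b - C (C c) * F ^ n with hb'
    have hDb' : D b' = 0 := by
      rw [hb', map_sub, D.leibniz, D.leibniz, D.leibniz_pow, D.leibniz_pow, hb, hDF, hDr, hDc]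
      simp
    have hb'n : b'.natDegree < n := by
      have h1 : b'.natDegree ≤ n := by
        rw [hb', ← C_pow]
        refine (natDegree_sub_le _ _).trans (max_le ?_ ?_)
        · exact (natDegree_C_mul_le _ _).trans hn.le
        · exact (natDegree_C_mul_le _ _).trans (by simpa using natDegree_pow_le_of_le n hF1)
      have h2 : b'.coeff n = 0 := by
        have h3 : (F ^ n).coeff n = (C r) ^ n := by
          simpa [hFc] using coeff_pow_of_natDegree_le (m := n) hF1
        rw [hb', ← C_pow, coeff_sub, coeff_C_mul, coeff_C_mul, hc, h3]
        ring
      refine lt_of_le_of_ne h1 fun h => ?_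
      have h4 : b' = 0 := by rw [← leadingCoeff_eq_zero, leadingCoeff, h, h2]
      rw [h4, natDegree_zero] at h
      omega
    obtain ⟨N, φ, hφ⟩ := ih _ hb'n b' hDb' rfl
    refine ⟨N + n, φ + C (r ^ N * c) * X ^ n, ?_⟩
    rw [map_add, ← hφ, hb', map_mul, aeval_C, map_pow, aeval_X, map_mul, map_pow]
    change _ = _ + C (C r) ^ N * C (C c) * F ^ n
    ring

/-- Reduction modulo `r`, followed by `Y ↦ 0`. -/
noncomputable def reduction (r : R) : R[X][X] →+* (R ⧸ Ideal.span {r})[X] :=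
  (mapRingHom (Ideal.Quotient.mk (Ideal.span {r}))).comp (evalRingHom 0)

theorem reduction_C (r : R) (a : R[X]) :
    reduction r (C a) = a.map (Ideal.Quotient.mk (Ideal.span {r})) := by
  simp [reduction]

theorem reduction_C_C_self (r : R) : reduction r (C (C r)) = 0 := by
  rw [reduction_C, map_C, Ideal.Quotient.mk_singleton_self, C_0]

theorem reduction_aeval (r : R) (G φ : R[X]) :
    reduction r (aeval (C (C r) * X - C G : R[X][X]) φ) =
      (φ.map (Ideal.Quotient.mk (Ideal.span {r}))).comp
        (-(G.map (Ideal.Quotient.mk (Ideal.span {r})))) := by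
  rw [aeval_def, hom_eval₂, comp, eval₂_map, map_sub, map_mul, reduction_C_C_self, zero_mul,
    zero_sub, reduction_C]
  congr 1
  ext a
  simp [reduction_C, Polynomial.algebraMap_apply]

theorem map_mk_eq_zero_iff (r : R) (φ : R[X]) :
    φ.map (Ideal.Quotient.mk (Ideal.span {r})) = 0 ↔ C r ∣ φ := by
  rw [C_dvd_iff_dvd_coeff, Polynomial.ext_iff]
  simp [Ideal.Quotient.eq_zero_iff_dvd]

theorem comp_neg_eq_zero_iff {K : Type*} [CommRing K] [IsDomain K] {φ G : K[X]}
    (hG : G.natDegree ≠ 0) : φ.comp (-G) = 0 ↔ φ = 0 := by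
  refine ⟨fun h => ?_, fun h => by simp [h]⟩
  rcases comp_eq_zero_iff.1 h with h | ⟨-, h⟩
  · exact h
  · exact absurd (by rw [← natDegree_neg, h, natDegree_C]) hG

/-- If `∫ g` is not constant modulo the prime `r`, then the kernel of `r ∂ₓ + g ∂ᵧ` consists of
the polynomials in `r Y - ∫ g`. -/
theorem exists_eq_aeval [IsDomain R] [CharZero R]
    {D : Derivation R R[X][X] R[X][X]} {r : R} (hrp : Prime r) {G : R[X]}
    (hr : D (C X) = C (C r)) (hg : D X = C (derivative G))
    (hG : (G.map (Ideal.Quotient.mk (Ideal.span {r}))).natDegree ≠ 0)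
    {b : R[X][X]} (hb : D b = 0) :
    ∃ φ : R[X], b = aeval (C (C r) * X - C G : R[X][X]) φ := by
  have : (Ideal.span {r}).IsPrime := (Ideal.span_singleton_prime hrp.ne_zero).2 hrp
  obtain ⟨N, φ, h⟩ := exists_pow_mul_eq_aeval hrp.ne_zero hr hg b hb
  induction N generalizing φ with
  | zero => exact ⟨φ, by simpa using h⟩
  | succ N ih =>
    -- F reduces to -G, nonconstant modulo r, so φ(F) ≡ 0 forces r ∣ φ and one factor r cancels.
    have h1 := congrArg (reduction r) h
    rw [reduction_aeval, map_mul, map_pow, reduction_C_C_self, zero_pow N.succ_ne_zero, zero_mul,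
      eq_comm, comp_neg_eq_zero_iff hG, map_mk_eq_zero_iff] at h1
    obtain ⟨ψ, rfl⟩ := h1
    refine ih ψ (mul_left_cancel₀ (a := (C (C r) : R[X][X])) (by simpa using hrp.ne_zero) ?_)
    rw [map_mul, aeval_C] at h
    change _ = C (C r) * _ at h
    rw [← h]
    ring

/-- A plinth element not divisible by `D X` makes the antiderivative linear modulo `r`. -/
theorem natDegree_map_eq_one [IsDomain R] [CharZero R]
    {D : Derivation R R[X][X] R[X][X]} {r : R} (hrp : Prime r) {G : R[X]}
    (hr : D (C X) = C (C r)) (hg : D X = C (derivative G))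
    (hG : (G.map (Ideal.Quotient.mk (Ideal.span {r}))).natDegree ≠ 0)
    {b : R[X][X]} (hb : D (D b) = 0) (hdvd : ¬ C (C r) ∣ D b) :
    (G.map (Ideal.Quotient.mk (Ideal.span {r}))).natDegree = 1 := by
  have : (Ideal.span {r}).IsPrime := (Ideal.span_singleton_prime hrp.ne_zero).2 hrp
  have hDr : D (C (C r)) = 0 := D.map_algebraMap r
  obtain ⟨φ, hφ⟩ := exists_eq_aeval hrp hr hg hG hb
  obtain ⟨ψ, hψ⟩ := exists_eq_aeval hrp hr hg hG (b := D b * C X - C (C r) * b) (by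
    rw [map_sub, D.leibniz, D.leibniz, hb, hDr, hr]
    simp only [smul_eq_mul]
    ring)
  have h := congrArg (reduction r) hψ
  rw [map_sub, map_mul, map_mul, reduction_C_C_self, zero_mul, sub_zero, hφ, reduction_aeval,
    reduction_aeval, reduction_C, map_X] at h
  have hφ0 : φ.map (Ideal.Quotient.mk (Ideal.span {r})) ≠ 0 := by
    rw [Ne, map_mk_eq_zero_iff]
    rintro ⟨φ', rfl⟩
    rw [map_mul, aeval_C] at hφ
    exact hdvd ⟨_, hφ⟩
  have h' := congrArg natDegree h
  rw [natDegree_mul_X (by rwa [Ne, comp_neg_eq_zero_iff hG]), natDegree_comp, natDegree_comp,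
    natDegree_neg] at h'
  -- With d = deg G modulo r, the degrees read (deg φ)d + 1 = (deg ψ)d, so d divides 1.
  exact Nat.dvd_one.1 ((Nat.dvd_add_right (Dvd.intro_left _ rfl)).1 (h' ▸ Dvd.intro_left _ rfl))

theorem exists_derivative_eq (k : Type*) [Field k] [CharZero k] [Algebra k R] (g : R[X]) :
    ∃ G : R[X], derivative G = g := by
  induction g using Polynomial.induction_on' with
  | add g g' h h' =>
    obtain ⟨G, hG⟩ := h
    obtain ⟨G', hG'⟩ := h'
    exact ⟨G + G', by simp [hG, hG']⟩
  | monomial n a =>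
    refine ⟨monomial (n + 1) (a * algebraMap k R ((n + 1 : k)⁻¹)), ?_⟩
    rw [derivative_monomial, Nat.add_sub_cancel]
    congr 1
    have hn : (n + 1 : k) ≠ 0 := Nat.cast_add_one_ne_zero n
    have : ((n + 1 : ℕ) : R) = algebraMap k R (n + 1) := by simp
    rw [this, mul_assoc, ← map_mul, inv_mul_cancel₀ hn, map_one, mul_one]

theorem charZero_of_algebra (k : Type*) [Field k] [CharZero k] (S : Type*) [CommRing S]
    [Nontrivial S] [Algebra k S] : CharZero S :=
  charZero_of_injective_algebraMap (algebraMap k S).injective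

/-- A plinth element not divisible by `D X` yields a second coordinate killed by `D²`. -/
theorem exists_sub_C_apply_apply_eq_zero (k : Type*) [Field k] [CharZero k] [Algebra k R]
    [IsDomain R] [UniqueFactorizationMonoid R]
    {D : Derivation R R[X][X] R[X][X]} (hnil : IsLocallyNilpotent D) (hirr : IsIrreducible D)
    (hD2 : D (D (C X)) = 0) (hDX : Irreducible (D (C X)))
    {b : R[X][X]} (hb : D (D b) = 0) (hdvd : ¬ D (C X) ∣ D b) :
    ∃ a : R[X], D (D (X - C a)) = 0 := by
  have := charZero_of_algebra k R
  obtain ⟨r, hr⟩ := hirr.exists_apply_C_X_eq hD2 hDX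
  obtain ⟨g, hg⟩ := hnil.exists_apply_X_eq hr
  have hrp : Prime r := by
    rw [← prime_C_iff, ← prime_C_iff, ← hr]
    exact hDX.prime
  have : (Ideal.span {r}).IsPrime := (Ideal.span_singleton_prime hrp.ne_zero).2 hrp
  have := charZero_of_algebra k (R ⧸ Ideal.span {r})
  have hrg : ¬ C r ∣ g := by
    rintro ⟨g', rfl⟩
    refine hirr ⟨D (C X), hDX.not_isUnit, fun P => ?_⟩
    obtain ⟨Q, -, hD⟩ := exists_eq_mul_add_mul_derivative D P
    rw [Ideal.mem_span_singleton, hD, hg, hr, C_mul]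
    exact dvd_add (dvd_mul_right _ _) ((dvd_mul_right _ _).mul_right _)
  obtain ⟨G, rfl⟩ := exists_derivative_eq k g
  have hG0 : (G.map (Ideal.Quotient.mk (Ideal.span {r}))).natDegree ≠ 0 := by
    intro h
    refine hrg ((map_mk_eq_zero_iff _ _).1 ?_)
    rw [← derivative_map, eq_C_of_natDegree_eq_zero h, derivative_C]
  have hG1 := natDegree_map_eq_one hrp hr hg hG0 hb (hr ▸ hdvd)
  have hdg : C r ∣ derivative G - C ((derivative G).coeff 0) := by
    have h0 : ((derivative G).map (Ideal.Quotient.mk (Ideal.span {r}))).natDegree = 0 := by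
      rw [← derivative_map]
      have := natDegree_derivative_le (G.map (Ideal.Quotient.mk (Ideal.span {r})))
      omega
    rw [← map_mk_eq_zero_iff, Polynomial.map_sub, map_C, eq_C_of_natDegree_eq_zero h0, coeff_map,
      sub_self]
  obtain ⟨g₁, hg₁⟩ := hdg
  obtain ⟨a, rfl⟩ := exists_derivative_eq k g₁
  refine ⟨a, ?_⟩
  obtain ⟨Q, hQ, hD⟩ := exists_eq_mul_add_mul_derivative D (C a)
  have hQ' : Q = C (derivative a) := by
    ext1 i
    rw [hQ]
    rcases i with _ | i <;> simp [coeff_C]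
  have : D (X - C a) = C (C ((derivative G).coeff 0)) := by
    rw [map_sub, hD, hQ', hg, hr, derivative_C, mul_zero, add_zero, ← C_mul, ← C_sub, ← hg₁]
    simp
  rw [this]
  exact D.map_algebraMap _

end Bivariate

/-! ### Transport along isomorphisms, and principal plinth ideals. -/

section Transport

variable {R : Type*} [CommRing R] {A B : Type*} [CommRing A] [Algebra R A] [CommRing B]
  [Algebra R B]

/-- Transport of a derivation along an isomorphism of algebras. -/
def conjDerivation (e : A ≃ₐ[R] B) (D : Derivation R B B) : Derivation R A A :=
  Derivation.mk' (e.symm.toLinearMap ∘ₗ D.toLinearMap ∘ₗ e.toLinearMap) fun a b => by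
    simp

theorem conjDerivation_apply (e : A ≃ₐ[R] B) (D : Derivation R B B) (a : A) :
    conjDerivation e D a = e.symm (D (e a)) := rfl

theorem IsLocallyNilpotent.conjDerivation {D : Derivation R B B} (h : IsLocallyNilpotent D)
    (e : A ≃ₐ[R] B) : IsLocallyNilpotent (conjDerivation e D) := by
  intro a
  obtain ⟨n, hn⟩ := h (e a)
  have hs : Function.Semiconj e.symm D (LND.conjDerivation e D) := fun b => by
    simp [conjDerivation_apply]
  refine ⟨n, ?_⟩
  have := (hs.iterate_right n).eq (e a)
  rw [hn, map_zero, e.symm_apply_apply] at this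
  exact this.symm

theorem IsIrreducible.conjDerivation {D : Derivation R B B} (h : IsIrreducible D)
    (e : A ≃ₐ[R] B) : IsIrreducible (conjDerivation e D) := by
  rintro ⟨a, ha, hD⟩
  refine h ⟨e a, by rwa [MulEquiv.isUnit_map], fun b => ?_⟩
  have := hD (e.symm b)
  rw [Ideal.mem_span_singleton, conjDerivation_apply, e.apply_symm_apply] at this
  simpa [Ideal.mem_span_singleton] using map_dvd e this

/-- If the images of a coordinate system lie in a principal plinth ideal, then an irreducible
derivation is fixed point free. -/
theorem IsIrreducible.isFixedPointFree_of_isPrincipal {D : Derivation R B B}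
    (hirr : IsIrreducible D) (hI : (plinthIdeal D).IsPrincipal) {n : ℕ} {x : Fin n → B}
    (hx : IsCoordinateSystem R x) (hD : ∀ i, D (D (x i)) = 0) : IsFixedPointFree D := by
  obtain ⟨q, hq⟩ := hI
  have hxq : ∀ i, (q : B) ∣ D (x i) := by
    intro i
    have hmem : (⟨D (x i), (mem_ker D).2 (hD i)⟩ : ker D) ∈ plinthIdeal D := ⟨x i, rfl⟩
    rw [hq] at hmem
    obtain ⟨c, hc⟩ := Ideal.mem_span_singleton.1 hmem
    exact ⟨c, congrArg Subtype.val hc⟩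
  have hunit : IsUnit (q : B) := by
    by_contra hu
    refine hirr ⟨q, hu, fun b => ?_⟩
    obtain ⟨P, rfl⟩ := hx.2 b
    rw [Ideal.mem_span_singleton]
    induction P using MvPolynomial.induction_on with
    | C a => simp
    | add P P' h h' =>
      rw [map_add, map_add]
      exact dvd_add h h'
    | mul_X P i h =>
      rw [map_mul, MvPolynomial.aeval_X, D.leibniz]
      exact dvd_add ((hxq i).mul_left _) (h.mul_left _)
  obtain ⟨b, hb⟩ : q ∈ plinthIdeal D := by
    rw [hq]
    exact Ideal.mem_span_singleton_self q
  exact Ideal.eq_top_of_isUnit_mem _ (Ideal.subset_span ⟨b, hb⟩) hunit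

end Transport

/-! ### Coordinate systems and the passage back to `MvPolynomial`. -/

theorem isCoordinateSystem_X {R : Type*} [CommRing R] {n : ℕ} :
    IsCoordinateSystem R (MvPolynomial.X : Fin n → MvPolynomial (Fin n) R) := by
  rw [IsCoordinateSystem, MvPolynomial.aeval_X_left]
  exact Function.bijective_id

theorem isCoordinateSystem_X_sub {R : Type*} [CommRing R] (a : R[X]) :
    IsCoordinateSystem R ![(MvPolynomial.X 0 : MvPolynomial (Fin 2) R),
      MvPolynomial.X 1 - aeval (MvPolynomial.X 0) a] := by
  set f : MvPolynomial (Fin 2) R →ₐ[R] MvPolynomial (Fin 2) R := MvPolynomial.aeval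
    ![(MvPolynomial.X 0 : MvPolynomial (Fin 2) R), MvPolynomial.X 1 - aeval (MvPolynomial.X 0) a]
    with hf
  set f' : MvPolynomial (Fin 2) R →ₐ[R] MvPolynomial (Fin 2) R := MvPolynomial.aeval
    ![(MvPolynomial.X 0 : MvPolynomial (Fin 2) R), MvPolynomial.X 1 + aeval (MvPolynomial.X 0) a]
    with hf'
  have h0 : f (MvPolynomial.X 0) = MvPolynomial.X 0 := by simp [hf]
  have h0' : f' (MvPolynomial.X 0) = MvPolynomial.X 0 := by simp [hf']
  have h1 : f (MvPolynomial.X 1) = MvPolynomial.X 1 - aeval (MvPolynomial.X 0) a := by simp [hf]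
  have h1' : f' (MvPolynomial.X 1) = MvPolynomial.X 1 + aeval (MvPolynomial.X 0) a := by simp [hf']
  have hl : f'.comp f = AlgHom.id R _ := by
    ext1 i
    fin_cases i
    · simp [h0, h0']
    · simp [h1, h1', ← aeval_algHom_apply, h0']
  have hr : f.comp f' = AlgHom.id R _ := by
    ext1 i
    fin_cases i
    · simp [h0, h0']
    · simp [h1, h1', ← aeval_algHom_apply, h0]
  exact Function.bijective_iff_has_inverse.2
    ⟨f', fun P => DFunLike.congr_fun hl P, fun P => DFunLike.congr_fun hr P⟩

theorem isQuasiNice_two_of_mem_plinthIdeal (k : Type*) {R : Type*} [Field k] [CharZero k]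
    [CommRing R] [IsDomain R] [UniqueFactorizationMonoid R] [Algebra k R]
    {D : Derivation R (MvPolynomial (Fin 2) R) (MvPolynomial (Fin 2) R)}
    (hnil : IsLocallyNilpotent D) (hirr : IsIrreducible D)
    (hD2 : D (D (MvPolynomial.X 0)) = 0) (hDX : Irreducible (D (MvPolynomial.X 0)))
    {b : MvPolynomial (Fin 2) R} (hb : D (D b) = 0) (hdvd : ¬ D (MvPolynomial.X 0) ∣ D b) :
    IsQuasiNice D 2 := by
  set e := Bivariate.equivMvPolynomial R
  have heX : e (C X) = MvPolynomial.X 0 := Bivariate.equivMvPolynomial_C_X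
  obtain ⟨a, ha⟩ := exists_sub_C_apply_apply_eq_zero k (D := conjDerivation e D)
    (hnil.conjDerivation e) (hirr.conjDerivation e)
    (by simp only [conjDerivation_apply, heX, e.apply_symm_apply, hD2, map_zero])
    (by rw [conjDerivation_apply, heX, MulEquiv.irreducible_iff]; exact hDX)
    (b := e.symm b) (by simp only [conjDerivation_apply, e.apply_symm_apply, hb, map_zero])
    (by
      rw [conjDerivation_apply, conjDerivation_apply, heX, e.apply_symm_apply, map_dvd_iff]
      exact hdvd)
  have hea : e (C a) = aeval (MvPolynomial.X 0) a := by
    have : (e : R[X][X] →ₐ[R] MvPolynomial (Fin 2) R).comp CAlgHom =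
        aeval (MvPolynomial.X 0 : MvPolynomial (Fin 2) R) := by
      ext
      simp [heX]
    exact DFunLike.congr_fun this a
  refine ⟨hnil, one_le_two, le_rfl, _, isCoordinateSystem_X_sub a, fun i _ => ?_⟩
  fin_cases i
  · exact hD2
  · have heY : e X = MvPolynomial.X 1 := Bivariate.equivMvPolynomial_X
    rw [conjDerivation_apply, conjDerivation_apply, e.apply_symm_apply, map_sub e, hea, heY,
      EmbeddingLike.map_eq_zero_iff] at ha
    exact ha

end LND

/-! ### The equivalence. -/

theorem mainTheorem6 {k R : Type*} [Field k] [CharZero k]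
    [CommRing R] [IsDomain R] [UniqueFactorizationMonoid R] [Algebra k R]
    (D : Derivation R (MvPolynomial (Fin 2) R) (MvPolynomial (Fin 2) R))
    (hnil : LND.IsLocallyNilpotent D)
    (hirr : LND.IsIrreducible D)
    (hfix : ¬ LND.IsFixedPointFree D)
    (hD2 : D (D (MvPolynomial.X 0)) = 0)
    (hDX : Irreducible (D (MvPolynomial.X 0))) :
    List.TFAE
      [(LND.plinthIdeal D).IsPrincipal,
        LND.plinthIdeal D = Ideal.span {⟨D (MvPolynomial.X 0), (LND.mem_ker D).2 hD2⟩},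
        LND.IsStrictlyQuasiNice D 1] := by
  tfae_have 1 → 3 := by
    refine fun hI => ⟨⟨hnil, le_rfl, one_le_two, _, LND.isCoordinateSystem_X, fun i hi => ?_⟩, ?_⟩
    · obtain rfl : i = 0 := by omega
      exact hD2
    · rintro r hr ⟨-, -, hr2, x, hx, hxD⟩
      exact hfix (hirr.isFixedPointFree_of_isPrincipal hI hx fun i => hxD i (by omega))
  tfae_have 3 → 2 := by
    rintro ⟨-, h⟩
    refine le_antisymm ?_ ((Ideal.span_singleton_le_iff_mem _).2 ⟨_, rfl⟩)
    rintro ⟨c, hc⟩ ⟨b, hb⟩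
    change D b = c at hb
    subst hb
    by_cases hdvd : D (MvPolynomial.X 0) ∣ D b
    · obtain ⟨c, hbc⟩ := hdvd
      -- The cofactor must lie in the kernel, as the span is taken there and not in B.
      have hcD : D c = 0 := by
        have h0 : D (D b) = 0 := hc
        rw [hbc, D.leibniz, hD2, smul_zero, add_zero, smul_eq_mul] at h0
        exact (mul_eq_zero.1 h0).resolve_left hDX.ne_zero
      exact Ideal.mem_span_singleton.2 ⟨⟨c, hcD⟩, Subtype.ext hbc⟩
    · exact absurd (LND.isQuasiNice_two_of_mem_plinthIdeal k hnil hirr hD2 hDX hc hdvd)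
        (h 2 one_lt_two)
  tfae_have 2 → 1 := fun h => ⟨_, h⟩
  tfae_finish
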